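/- Let $m,n\ge 0$ be integers and let $(\mathbf z_t)_{t\ge 0}$ be an $\mathbb R^n$-valued latent process (on a standard Borel space) whose law may change across $m$ contexts $u_1,\dots,u_m$; let $\mathbf x_t=\mathbf g(\mathbf z_t)$ be the observations, where $\mathbf g:\mathbb R^n\to\mathcal X$ is injective, and let $\hat{\mathbf z}_t=\hat{\mathbf g}(\mathbf x_t)\in\mathbb R^n$ be the estimated latents, where $\hat{\mathbf g}$ is injective on the range of $\mathbf g$. Assume that $\hat{\mathbf g}\circ\mathbf g:\mathbb R^n\to\mathbb R^n$ is of class $C^2$ with nowhere vanishing Jacobian determinant. Fix $t\ge 1$ and assume that in each context $u_r$: 1. $\mathbf z_t$ is independent of $\mathbf z_{t-1}$, and the components $z_{1t},\dots,z_{nt}$ of $\mathbf z_t$ are mutually independent; 2. each $z_{kt}$ has a positive density $p(z_{kt}\mid u_r)$ on $\mathbb R$ such that $\eta_{kt}(u_r)=\log p(z_{kt}\mid u_r)$ is twice differentiable in $z_{kt}$ on all of $\mathbb R$; 3. the components of $\hat{\mathbf z}_t$ are mutually independent conditional on $\hat{\mathbf z}_{t-1}$. For $k=1,\dots,n$ put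 $$\mathbf v_{kt}(u_r)=\Big(\tfrac{\partial^2\eta_{kt}(u_r)}{\partial z_{kt}\,\partial z_{l,t-1}}\Big)_{l=1}^n,\qquad \mathring{\mathbf v}_{kt}(u_r)=\Big(\tfrac{\partial^3\eta_{kt}(u_r)}{\partial z_{kt}^2\,\partial z_{l,t-1}}\Big)_{l=1}^n$$ (these vanish here, because $\eta_{kt}(u_r)$ does not involve $\mathbf z_{t-1}$), and $$\mathbf s_{kt}=\Big(\mathbf v_{kt}(u_1)^\top,\dots,\mathbf v_{kt}(u_m)^\top,\ \tfrac{\partial^2\eta_{kt}(u_2)}{\partial z_{kt}^2}-\tfrac{\partial^2\eta_{kt}(u_1)}{\partial z_{kt}^2},\dots,\tfrac{\partial^2\eta_{kt}(u_m)}{\partial z_{kt}^2}-\tfrac{\partial^2\eta_{kt}(u_{m-1})}{\partial z_{kt}^2}\Big)^\top,$$ $$\mathring{\mathbf s}_{kt}=\Big(\mathring{\mathbf v}_{kt}(u_1)^\top,\dots,\mathring{\mathbf v}_{kt}(u_m)^\top,\ \tfrac{\partial\eta_{kt}(u_2)}{\partial z_{kt}}-\tfrac{\partial\eta_{kt}(u_1)}{\partial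 z_{kt}},\dots,\tfrac{\partial\eta_{kt}(u_m)}{\partial z_{kt}}-\tfrac{\partial\eta_{kt}(u_{m-1})}{\partial z_{kt}}\Big)^\top.$$ If for each value of $\mathbf z_t\in\mathbb R^n$ the $2n$ vectors $\mathbf s_{1t},\mathring{\mathbf s}_{1t},\dots,\mathbf s_{nt},\mathring{\mathbf s}_{nt}$, as vector functions of $\mathbf z_{t-1}\in\mathbb R^n$, are linearly independent over $\mathbb R$, then $\hat{\mathbf z}_t$ is a permuted invertible component-wise transformation of $\mathbf z_t$: there are a permutation $\sigma$ of $\{1,\dots,n\}$ and injective functions $T_1,\dots,T_n:\mathbb R\to\mathbb R$ such that $\hat{\mathbf g}(\mathbf g(\mathbf z))_i=T_i(z_{\sigma(i)})$ for all $\mathbf z\in\mathbb R^n$ and all $i$; in particular $\hat z_{it}=T_i(z_{\sigma(i),t})$. -/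

import Mathlib

open MeasureTheory ProbabilityTheory

noncomputable section

namespace TemporalLatent

/-- The vector `v_k` with entries `∂²η / ∂z_k ∂w_l`, `l = 1, …, n`, where `η ζ w` is the
log-density of the `k`-th current latent component at the value `ζ`, given the
previous latent vector `w`. -/
def vVec {n : ℕ} (η : ℝ → (Fin n → ℝ) → ℝ) (ζ : ℝ) (w : Fin n → ℝ) (l : Fin n) : ℝ :=
  deriv (fun y => deriv (fun x => η x (Function.update w l y)) ζ) (w l)

/-- The vector `v̊_k` with entries `∂³η / ∂z_k² ∂w_l`, `l = 1, …, n`. -/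
def vRing {n : ℕ} (η : ℝ → (Fin n → ℝ) → ℝ) (ζ : ℝ) (w : Fin n → ℝ) (l : Fin n) : ℝ :=
  deriv (fun y => iteratedDeriv 2 (fun x => η x (Function.update w l y)) ζ) (w l)

/-- The vector function `w ↦ s_k`, for a fixed value `ζ` of the `k`-th current component. Here
`η r` is the log-density of that component in context `r`. The entries are those of `v_k` in all
the contexts, followed by the differences of `∂²η / ∂z_k²` between consecutive contexts. -/
def sVec {m n : ℕ} (η : Fin m → ℝ → (Fin n → ℝ) → ℝ) (ζ : ℝ) (w : Fin n → ℝ) :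
    (Fin m × Fin n) ⊕ Fin (m - 1) → ℝ
  | Sum.inl (r, l) => vVec (η r) ζ w l
  | Sum.inr r =>
      iteratedDeriv 2 (fun x => η ⟨r.val + 1, by have := r.isLt; omega⟩ x w) ζ
        - iteratedDeriv 2 (fun x => η ⟨r.val, by have := r.isLt; omega⟩ x w) ζ

/-- The vector function `w ↦ s̊_k`: the entries of `v̊_k` in all the contexts, followed by the
differences of `∂η / ∂z_k` between consecutive contexts. -/
def sRing {m n : ℕ} (η : Fin m → ℝ → (Fin n → ℝ) → ℝ) (ζ : ℝ) (w : Fin n → ℝ) :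
    (Fin m × Fin n) ⊕ Fin (m - 1) → ℝ
  | Sum.inl (r, l) => vRing (η r) ζ w l
  | Sum.inr r =>
      deriv (fun x => η ⟨r.val + 1, by have := r.isLt; omega⟩ x w) ζ
        - deriv (fun x => η ⟨r.val, by have := r.isLt; omega⟩ x w) ζ

/-- The components of the random vector `Y` are mutually independent conditional on the random
vector `W`, under the measure `μ`. -/
def CondIndepComponents {Ω : Type*} [MeasurableSpace Ω] [StandardBorelSpace Ω] {n : ℕ}
    (μ : Measure Ω) [IsFiniteMeasure μ] (Y W : Ω → Fin n → ℝ) (hW : Measurable W) : Prop :=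
  iCondIndepFun (MeasurableSpace.comap W inferInstance) hW.comap_le (fun i ω => Y ω i) μ

end TemporalLatent

end

/-! Write `h = ghat ∘ g`, with inverse `ψ` on its open range. In every context both the law of `z`
and its image under `h` are product measures: conditioning on an independent past changes nothing.
For two consecutive contexts the log-likelihood ratio is a sum `D z = ∑ d_k (z_k)`. A ratio involves
no Jacobian, so `D ∘ ψ` is the log-ratio of two product laws and should split into functions of
single coordinates. Its mixed derivatives then vanish: `∑ (d_k'' ∂_i ψ_k ∂_j ψ_k + d_k' ∂_i ∂_j ψ_k)
= 0` for `i ≠ j`. Linear independence forces `∂_i ψ_k ∂_j ψ_k = 0`, so the derivative of `h` is a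
generalized permutation matrix, with a constant pattern because the space is connected.

No density of the estimated components is ever differentiated. The splitting is expressed as
invariance under exchanging one coordinate between two points (`density_swapCoord_ae`), which holds
almost everywhere and extends by continuity (`add_eq_add_of_map_eq_pi`). The derivative identity is
`sum_second_deriv_eq_zero`; the conclusion rests on `exists_perm_of_leftInverse` and
`exists_componentwise`. -/

namespace TemporalLatent

/-! ### Removing the conditioning on the past -/

/-- Components that are independent conditional on an independent vector are independent. -/
theorem iIndepFun_of_condIndepComponents {Ω : Type*} [MeasurableSpace Ω] [StandardBorelSpace Ω]
    {n : ℕ} {μ : Measure Ω} [IsProbabilityMeasure μ] {Y W : Ω → Fin n → ℝ} (hY : Measurable Y)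
    (hW : Measurable W) (hind : IndepFun W Y μ) (h : CondIndepComponents μ Y W hW) :
    iIndepFun (fun i ω => Y ω i) μ := by
  have hYi : ∀ i, Measurable (fun ω => Y ω i) := fun i => (measurable_pi_apply i).comp hY
  rw [CondIndepComponents,
    iCondIndepFun_iff_condExp_inter_preimage_eq_mul _ _ hYi] at h
  rw [iIndepFun_iff_measure_inter_preimage_eq_mul]
  intro S sets hs
  have key : ∀ A : Set Ω, MeasurableSet[MeasurableSpace.comap Y inferInstance] A →
      μ[A.indicator (fun _ => (1 : ℝ)) | MeasurableSpace.comap W inferInstance]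
        =ᵐ[μ] fun _ => μ.real A := by
    intro A hA
    have h1 := condExp_indep_eq (μ := μ) hY.comap_le hW.comap_le
      (f := A.indicator (fun _ => (1 : ℝ)))
      (stronglyMeasurable_const.indicator hA) hind.symm
    rwa [integral_indicator_const _ (hY.comap_le _ hA), smul_eq_mul, mul_one] at h1
  have hmeas : ∀ i ∈ S, MeasurableSet[MeasurableSpace.comap Y inferInstance]
      ((fun ω => Y ω i) ⁻¹' sets i) := fun i hi =>
    ⟨(fun y : Fin n → ℝ => y i) ⁻¹' sets i, measurable_pi_apply i (hs i hi), rfl⟩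
  have h1 := h S hs
  have h2 := key _ (S.measurableSet_biInter hmeas)
  have h3 : (∏ i ∈ S, μ[((fun ω => Y ω i) ⁻¹' sets i).indicator (fun _ => (1 : ℝ)) |
      MeasurableSpace.comap W inferInstance])
      =ᵐ[μ] fun _ => ∏ i ∈ S, μ.real ((fun ω => Y ω i) ⁻¹' sets i) := by
    have : ∀ᵐ ω ∂μ, ∀ i ∈ S, (μ[((fun ω => Y ω i) ⁻¹' sets i).indicator (fun _ => (1 : ℝ)) |
      MeasurableSpace.comap W inferInstance]) ω = μ.real ((fun ω => Y ω i) ⁻¹' sets i) :=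
      (Filter.eventually_all_finset S).2 fun i hi => key _ (hmeas i hi)
    filter_upwards [this] with ω hω
    rw [Finset.prod_apply]
    exact Finset.prod_congr rfl hω
  have h4 := (h2.symm.trans h1).trans h3
  -- Both sides are constants, so one point of agreement suffices.
  obtain ⟨ω, hω⟩ := h4.exists
  have h5 : (μ (⋂ i ∈ S, (fun ω => Y ω i) ⁻¹' sets i)).toReal
      = (∏ i ∈ S, μ ((fun ω => Y ω i) ⁻¹' sets i)).toReal := by
    rw [ENNReal.toReal_prod]; exact hω
  exact (ENNReal.toReal_eq_toReal_iff' (measure_ne_top _ _)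
    (ENNReal.prod_ne_top fun i _ => measure_ne_top _ _)).1 h5

/-! ### Product measures and exchange of a coordinate -/

theorem pi_withDensity_eq {ι : Type*} [Fintype ι] (m : ι → Measure ℝ)
    [∀ k, IsProbabilityMeasure (m k)] {f : ι → ℝ → ENNReal} (hf : ∀ k, Measurable (f k))
    [∀ k, SigmaFinite ((m k).withDensity (f k))] :
    Measure.pi (fun k => (m k).withDensity (f k))
      = (Measure.pi m).withDensity (fun z => ∏ k, f k (z k)) := by
  refine Measure.pi_eq fun s hs => ?_
  have hg : ∀ k, Measurable ((s k).indicator (f k)) := fun k => (hf k).indicator (hs k)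
  have hmp : ∀ k, MeasurePreserving (Function.eval k) (Measure.pi m) (m k) :=
    fun k => measurePreserving_eval m k
  rw [withDensity_apply _ (MeasurableSet.univ_pi hs),
    ← lintegral_indicator (MeasurableSet.univ_pi hs)]
  have h1 : ((Set.univ.pi s).indicator fun z : ι → ℝ => ∏ k, f k (z k))
      = fun z => ∏ k, (s k).indicator (f k) (z k) := by
    classical
    ext z
    by_cases hz : z ∈ Set.univ.pi s
    · rw [Set.indicator_of_mem hz]
      exact Finset.prod_congr rfl fun k _ => (Set.indicator_of_mem (hz k trivial) _).symm
    · rw [Set.indicator_of_notMem hz]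
      simp only [Set.mem_univ_pi, not_forall] at hz
      obtain ⟨k, hk⟩ := hz
      exact (Finset.prod_eq_zero (Finset.mem_univ k) (Set.indicator_of_notMem hk _)).symm
  rw [h1]
  have h2 := lintegral_prod_eq_prod_lintegral_of_indepFun (μ := Measure.pi m) Finset.univ
    (fun k z => (s k).indicator (f k) (z k))
    (iIndepFun_pi (μ := m) (X := fun k => (s k).indicator (f k)) fun k => (hg k).aemeasurable)
    (fun k => ((hg k).comp (measurable_pi_apply k)))
  rw [h2]
  refine Finset.prod_congr rfl fun k _ => ?_
  rw [withDensity_apply _ (hs k), ← lintegral_indicator (hs k), ← (hmp k).lintegral_comp (hg k)]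

/-- Exchange the `i`-th coordinates of two vectors. -/
def swapCoord {ι : Type*} [DecidableEq ι] (i : ι) (y : (ι → ℝ) × (ι → ℝ)) : (ι → ℝ) × (ι → ℝ) :=
  (Function.update y.1 i (y.2 i), Function.update y.2 i (y.1 i))

theorem swapCoord_swapCoord {ι : Type*} [DecidableEq ι] (i : ι) (y : (ι → ℝ) × (ι → ℝ)) :
    swapCoord i (swapCoord i y) = y := by
  ext k <;> by_cases h : k = i <;> simp [swapCoord, h]

theorem continuous_swapCoord {ι : Type*} [DecidableEq ι] (i : ι) :
    Continuous (swapCoord i) := by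
  unfold swapCoord; fun_prop

/-- On a product of two boxes the exchange only permutes the two `i`-th sides, both measured by `m
i`, and such products generate the σ-algebra. -/
theorem measurePreserving_swapCoord {ι : Type*} [Fintype ι] [DecidableEq ι] (i : ι)
    (m : ι → Measure ℝ) [∀ k, IsProbabilityMeasure (m k)] :
    MeasurePreserving (swapCoord i) ((Measure.pi m).prod (Measure.pi m))
      ((Measure.pi m).prod (Measure.pi m)) := by
  have hS : Measurable (swapCoord i) := (continuous_swapCoord i).measurable
  refine ⟨hS, ?_⟩
  set C : Set (Set (ι → ℝ)) := Set.pi Set.univ '' Set.pi Set.univ fun _ => {s : Set ℝ | MeasurableSet s}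
  have hC : MeasurableSpace.generateFrom C = MeasurableSpace.pi := generateFrom_pi
  have hpiC : IsPiSystem C := isPiSystem_pi
  let span : (Measure.pi m).FiniteSpanningSetsIn C :=
    ⟨fun _ => Set.univ, fun _ => ⟨fun _ => Set.univ, by simp, by simp⟩, by simp, Set.iUnion_const _⟩
  refine (Measure.prod_eq_generateFrom hC hC hpiC hpiC span span ?_).symm
  rintro _ ⟨a, ha, rfl⟩ _ ⟨b, hb, rfl⟩
  simp only [Set.mem_univ_pi, Set.mem_ofPred_eq] at ha hb
  have hpre : swapCoord i ⁻¹' (Set.univ.pi a ×ˢ Set.univ.pi b)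
      = Set.univ.pi (Function.update a i (b i)) ×ˢ Set.univ.pi (Function.update b i (a i)) := by
    ext ⟨y, y'⟩
    simp only [swapCoord, Set.mem_preimage, Set.mem_prod, Set.mem_univ_pi]
    constructor
    · rintro ⟨h1, h2⟩
      refine ⟨fun k => ?_, fun k => ?_⟩ <;> by_cases hk : k = i
      · subst hk; simpa using h2 k
      · simpa [hk] using h1 k
      · subst hk; simpa using h1 k
      · simpa [hk] using h2 k
    · rintro ⟨h1, h2⟩
      refine ⟨fun k => ?_, fun k => ?_⟩ <;> by_cases hk : k = i
      · subst hk; simpa using h2 k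
      · simpa [hk] using h1 k
      · subst hk; simpa using h1 k
      · simpa [hk] using h2 k
  rw [Measure.map_apply hS ((MeasurableSet.univ_pi ha).prod (MeasurableSet.univ_pi hb)), hpre,
    Measure.prod_prod]
  simp only [Measure.pi_pi, ← Finset.prod_mul_distrib]
  refine Finset.prod_congr rfl fun k _ => ?_
  by_cases hk : k = i
  · subst hk; simp [mul_comm]
  · simp [hk]

/-- If two product measures have density `G` with respect to each other, then `G ⊗ G` is almost
everywhere invariant under the exchange of a coordinate. -/
theorem density_swapCoord_ae {ι : Type*} [Fintype ι] [DecidableEq ι] (i : ι)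
    (m m' : ι → Measure ℝ) [∀ k, IsProbabilityMeasure (m k)] [∀ k, IsProbabilityMeasure (m' k)]
    {G : (ι → ℝ) → ENNReal} (hG : Measurable G)
    (h : Measure.pi m' = (Measure.pi m).withDensity G) :
    ∀ᵐ y ∂(Measure.pi m).prod (Measure.pi m),
      G y.1 * G y.2 = G (swapCoord i y).1 * G (swapCoord i y).2 := by
  have hS := measurePreserving_swapCoord i m
  have hS' := measurePreserving_swapCoord i m'
  set H : (ι → ℝ) × (ι → ℝ) → ENNReal := fun y => G y.1 * G y.2
  have hH : Measurable H := (hG.comp measurable_fst).mul (hG.comp measurable_snd)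
  have : SFinite ((Measure.pi m).withDensity G) := h ▸ inferInstance
  have hprod : (Measure.pi m').prod (Measure.pi m')
      = ((Measure.pi m).prod (Measure.pi m)).withDensity H := by
    rw [h, prod_withDensity hG hG]
  -- The exchange preserves both the reference measure and the measure of density `H`, and it is an
  -- involution; hence `H` and `H ∘ swapCoord i` are densities of the same measure.
  have hmain : ((Measure.pi m).prod (Measure.pi m)).withDensity H
      = ((Measure.pi m).prod (Measure.pi m)).withDensity (H ∘ swapCoord i) := by
    ext s hs
    rw [← hprod, ← hS'.measure_preimage hs.nullMeasurableSet, hprod,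
      withDensity_apply _ (hS.measurable hs), withDensity_apply _ hs,
      ← lintegral_indicator (hS.measurable hs), ← lintegral_indicator hs,
      ← hS.lintegral_comp (hH.indicator (hS.measurable hs))]
    refine lintegral_congr fun y => ?_
    by_cases hy : y ∈ s
    · rw [Set.indicator_of_mem hy, Set.indicator_of_mem]
      · rfl
      · rwa [Set.mem_preimage, swapCoord_swapCoord]
    · rw [Set.indicator_of_notMem hy, Set.indicator_of_notMem]
      rwa [Set.mem_preimage, swapCoord_swapCoord]
  exact (withDensity_eq_iff_of_sigmaFinite hH.aemeasurable
    (hH.comp hS.measurable).aemeasurable).1 hmain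

/-- If `h` maps `μ` and `exp D • μ` to product measures, then `z ↦ D z` is, in the coordinates
`h z`, invariant under the exchange of coordinates. -/
theorem add_eq_add_of_map_eq_pi {n : ℕ} {h : (Fin n → ℝ) → (Fin n → ℝ)}
    (hh : Topology.IsOpenEmbedding h) {μ μ' : Measure (Fin n → ℝ)} [IsProbabilityMeasure μ]
    [μ.IsOpenPosMeasure] {D : (Fin n → ℝ) → ℝ} (hD : Continuous D)
    (hμ : μ' = μ.withDensity (fun z => ENNReal.ofReal (Real.exp (D z))))
    {m m' : Fin n → Measure ℝ} [∀ k, IsProbabilityMeasure (m k)]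
    [∀ k, IsProbabilityMeasure (m' k)]
    (hm : μ.map h = Measure.pi m) (hm' : μ'.map h = Measure.pi m')
    {i : Fin n} {z z' w w' : Fin n → ℝ} (hw : h w = Function.update (h z) i (h z' i))
    (hw' : h w' = Function.update (h z') i (h z i)) :
    D z + D z' = D w + D w' := by
  have hme := hh.measurableEmbedding
  obtain ⟨G, hG, hGh⟩ := hme.exists_measurable_extend
    (g := fun z => ENNReal.ofReal (Real.exp (D z))) (by fun_prop) (fun _ => inferInstance)
  have hGh' : ∀ z, G (h z) = ENNReal.ofReal (Real.exp (D z)) := fun z => congrFun hGh z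
  have hdens : Measure.pi m' = (Measure.pi m).withDensity G := by
    rw [← hm, ← hm', hμ]
    ext s hs
    rw [Measure.map_apply hme.measurable hs, withDensity_apply _ (hme.measurable hs),
      withDensity_apply _ hs, setLIntegral_map hs hG hme.measurable]
    simp only [hGh']
  have hae := density_swapCoord_ae i m m' hG hdens
  rw [← hm, Measure.map_prod_map _ _ hme.measurable hme.measurable] at hae
  have hae := ae_of_ae_map (hme.measurable.prodMap hme.measurable).aemeasurable hae
  have hinv : ∀ y ∈ Set.range h, h ((hh.toOpenPartialHomeomorph h).symm y) = y := fun y hy =>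
    hh.toOpenPartialHomeomorph_right_inv h hy
  have hcont : ContinuousOn (hh.toOpenPartialHomeomorph h).symm (Set.range h) := by
    have := (hh.toOpenPartialHomeomorph h).continuousOn_symm
    rwa [hh.toOpenPartialHomeomorph_target] at this
  set ψ := (hh.toOpenPartialHomeomorph h).symm with hψ
  let S : (Fin n → ℝ) × (Fin n → ℝ) → (Fin n → ℝ) × (Fin n → ℝ) :=
    fun x => swapCoord i (h x.1, h x.2)
  have hS : Continuous S := (continuous_swapCoord i).comp
    ((hh.continuous.comp continuous_fst).prodMk (hh.continuous.comp continuous_snd))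
  -- The range of `h` need not be a box, so only pairs whose exchange stays in the range are
  -- compared.
  set U : Set ((Fin n → ℝ) × (Fin n → ℝ)) := S ⁻¹' (Set.range h ×ˢ Set.range h) with hU
  have hUo : IsOpen U := (hh.isOpen_range.prod hh.isOpen_range).preimage hS
  have hc1 : ContinuousOn (fun x => D (ψ (S x).1)) U :=
    hD.comp_continuousOn (hcont.comp (continuous_fst.comp hS).continuousOn fun x hx => hx.1)
  have hc2 : ContinuousOn (fun x => D (ψ (S x).2)) U :=
    hD.comp_continuousOn (hcont.comp (continuous_snd.comp hS).continuousOn fun x hx => hx.2)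
  have hc : ContinuousOn (fun x : (Fin n → ℝ) × (Fin n → ℝ) =>
      D x.1 + D x.2 - (D (ψ (S x).1) + D (ψ (S x).2))) U :=
    (Continuous.continuousOn (by fun_prop)).sub (hc1.add hc2)
  -- The failure set of the identity is open and null, hence empty, as `μ` charges every nonempty
  -- open set.
  have hO := hc.isOpen_inter_preimage hUo (isOpen_compl_singleton (x := (0 : ℝ)))
  have hnull : (μ.prod μ) (U ∩ (fun x : (Fin n → ℝ) × (Fin n → ℝ) =>
      D x.1 + D x.2 - (D (ψ (S x).1) + D (ψ (S x).2))) ⁻¹' {0}ᶜ) = 0 := by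
    refine measure_mono_null (fun x hx => ?_) (ae_iff.1 hae)
    obtain ⟨⟨hx1, hx2⟩, hx3⟩ := hx
    intro heq
    apply hx3
    change G (h x.1) * G (h x.2) = G (S x).1 * G (S x).2 at heq
    rw [← hinv _ hx1, ← hinv _ hx2] at heq
    simp only [hGh'] at heq
    rw [← ENNReal.ofReal_mul (Real.exp_pos _).le, ← ENNReal.ofReal_mul (Real.exp_pos _).le,
      ← Real.exp_add, ← Real.exp_add,
      ENNReal.ofReal_eq_ofReal_iff (Real.exp_pos _).le (Real.exp_pos _).le, Real.exp_eq_exp] at heq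
    exact sub_eq_zero.2 heq
  have hempty := (hO.measure_eq_zero_iff _).1 hnull
  have hS1 : (S (z, z')).1 = h w := hw.symm
  have hS2 : (S (z, z')).2 = h w' := hw'.symm
  have hψh : ∀ x, ψ (h x) = x := fun x => hh.toOpenPartialHomeomorph_left_inv h
  by_contra hne
  have : (z, z') ∈ (∅ : Set ((Fin n → ℝ) × (Fin n → ℝ))) := by
    rw [← hempty]
    refine ⟨⟨⟨w, hS1.symm⟩, ⟨w', hS2.symm⟩⟩, fun h0 => hne ?_⟩
    have h0 : D z + D z' - (D (ψ (S (z, z')).1) + D (ψ (S (z, z')).2)) = 0 := h0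
    rw [hS1, hS2, hψh, hψh] at h0
    exact sub_eq_zero.1 h0
  exact this

/-! ### From exchange invariance to mixed derivatives -/

/-- If `y ↦ ∑ k, d k (ψ y k)` is invariant under the exchange of the `i`-th coordinates, then its
mixed second derivatives in the directions `i` and `j ≠ i` vanish. -/
theorem sum_second_deriv_eq_zero {n : ℕ} {ψ : (Fin n → ℝ) → (Fin n → ℝ)} {V : Set (Fin n → ℝ)}
    (hV : IsOpen V) (hψ : ContDiffOn ℝ 2 ψ V) {d : Fin n → ℝ → ℝ}
    (hd : ∀ k, Differentiable ℝ (d k)) (hd2 : ∀ k, Differentiable ℝ (deriv (d k)))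
    {i j : Fin n} (hij : i ≠ j)
    (hex : ∀ y ∈ V, ∀ y' ∈ V, Function.update y i (y' i) ∈ V → Function.update y' i (y i) ∈ V →
      ∑ k, d k (ψ y k) + ∑ k, d k (ψ y' k)
        = ∑ k, d k (ψ (Function.update y i (y' i)) k)
          + ∑ k, d k (ψ (Function.update y' i (y i)) k))
    {y : Fin n → ℝ} (hy : y ∈ V) :
    ∑ k, (deriv (deriv (d k)) (ψ y k)
          * (fderiv ℝ ψ y (Pi.single j 1) k * fderiv ℝ ψ y (Pi.single i 1) k)
        + deriv (d k) (ψ y k)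
          * fderiv ℝ (fun x => fderiv ℝ ψ x (Pi.single i 1)) y (Pi.single j 1) k) = 0 := by
  set ei : Fin n → ℝ := Pi.single i 1
  set ej : Fin n → ℝ := Pi.single j 1
  have hline : ∀ (x v : Fin n → ℝ), HasDerivAt (fun a : ℝ => x + a • v) v 0 := fun x v => by
    simpa using ((hasDerivAt_id (0 : ℝ)).smul_const v).const_add x
  have hlc : ∀ (x v : Fin n → ℝ), ContinuousAt (fun a : ℝ => x + a • v) 0 :=
    fun x v => (hline x v).continuousAt
  have hmem : ∀ (x v : Fin n → ℝ), x ∈ V → ∀ᶠ a : ℝ in nhds 0, x + a • v ∈ V := fun x v hx =>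
    (hlc x v).eventually_mem (by simpa using hV.mem_nhds hx)
  have hψd : ∀ x ∈ V, HasFDerivAt ψ (fderiv ℝ ψ x) x := fun x hx =>
    ((hψ.contDiffAt (hV.mem_nhds hx)).differentiableAt (by norm_num)).hasFDerivAt
  have hψl : ∀ x ∈ V, ∀ (v : Fin n → ℝ) (k : Fin n),
      HasDerivAt (fun a : ℝ => ψ (x + a • v) k) (fderiv ℝ ψ x v k) 0 := by
    intro x hx v k
    have h1 : HasFDerivAt ψ (fderiv ℝ ψ x) (x + (0 : ℝ) • v) := by simpa using hψd x hx
    exact hasDerivAt_pi.1 (h1.comp_hasDerivAt (0 : ℝ) (hline x v)) k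
  have hF : ∀ x ∈ V, HasDerivAt (fun a : ℝ => ∑ k, d k (ψ (x + a • ei) k))
      (∑ k, deriv (d k) (ψ x k) * fderiv ℝ ψ x ei k) 0 := by
    intro x hx
    refine HasDerivAt.fun_sum fun k _ => ?_
    have h1 : HasDerivAt (d k) (deriv (d k) (ψ x k)) (ψ (x + (0 : ℝ) • ei) k) := by
      simpa using (hd k (ψ x k)).hasDerivAt
    exact h1.comp (0 : ℝ) (hψl x hx ei k)
  -- Exchanging the `i`-th coordinates of `y + b e_j + a e_i` and `y` gives `y + b e_j` and `y + a
  -- e_i`. The increment along `e_i` is thus the same from `y + b e_j` as from `y`, and so is its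
  -- derivative at `a = 0`.
  have hconst : ∀ᶠ b : ℝ in nhds 0,
      ∑ k, deriv (d k) (ψ (y + b • ej) k) * fderiv ℝ ψ (y + b • ej) ei k
        = ∑ k, deriv (d k) (ψ y k) * fderiv ℝ ψ y ei k := by
    filter_upwards [hmem y ej hy] with b hb
    have h1 := hF _ hb
    have h2 := ((hF y hy).add_const (∑ k, d k (ψ (y + b • ej) k))).sub_const (∑ k, d k (ψ y k))
    refine h1.unique (h2.congr_of_eventuallyEq ?_)
    filter_upwards [hmem _ ei hb, hmem y ei hy] with a ha ha'
    have e1 : Function.update (y + b • ej + a • ei) i (y i) = y + b • ej := by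
      ext k
      by_cases hk : k = i
      · subst hk; simp [ej, hij]
      · simp [hk, ei]
    have e2 : Function.update y i ((y + b • ej + a • ei) i) = y + a • ei := by
      ext k
      by_cases hk : k = i
      · subst hk; simp [ej, ei, hij]
      · simp [hk, ei]
    have := hex _ ha y hy (by rw [e1]; exact hb) (by rw [e2]; exact ha')
    rw [e1, e2] at this
    linarith
  have hd2ψ : HasFDerivAt (fun x => fderiv ℝ ψ x ei)
      (fderiv ℝ (fun x => fderiv ℝ ψ x ei) y) (y + (0 : ℝ) • ej) := by
    have h1 : ContDiffAt ℝ 1 (fderiv ℝ ψ) y :=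
      (hψ.contDiffAt (hV.mem_nhds hy)).fderiv_right (by norm_num)
    have h2 : DifferentiableAt ℝ (fun x => fderiv ℝ ψ x ei) y :=
      (h1.differentiableAt (by norm_num)).clm_apply (differentiableAt_const _)
    simpa using h2.hasFDerivAt
  have hq : HasDerivAt (fun b : ℝ =>
      ∑ k, deriv (d k) (ψ (y + b • ej) k) * fderiv ℝ ψ (y + b • ej) ei k)
      (∑ k, (deriv (deriv (d k)) (ψ y k) * (fderiv ℝ ψ y ej k * fderiv ℝ ψ y ei k)
        + deriv (d k) (ψ y k) * fderiv ℝ (fun x => fderiv ℝ ψ x ei) y ej k)) 0 := by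
    refine HasDerivAt.fun_sum fun k _ => ?_
    have h1 : HasDerivAt (deriv (d k)) (deriv (deriv (d k)) (ψ y k)) (ψ (y + (0 : ℝ) • ej) k) := by
      simpa using (hd2 k (ψ y k)).hasDerivAt
    have h2 := hasDerivAt_pi.1 (hd2ψ.comp_hasDerivAt (0 : ℝ) (hline y ej)) k
    have h3 := (h1.comp (0 : ℝ) (hψl y hy ej k)).mul h2
    refine h3.congr_deriv ?_
    simp [mul_assoc]
  exact hq.unique ((hasDerivAt_const (0 : ℝ) _).congr_of_eventuallyEq hconst)

/-! ### Generalized permutation matrices and component-wise maps -/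

theorem clm_apply_eq_sum {n : ℕ} (A : (Fin n → ℝ) →L[ℝ] (Fin n → ℝ)) (v : Fin n → ℝ)
    (k : Fin n) : A v k = ∑ i, v i * A (Pi.single i 1) k := by
  conv_lhs => rw [pi_eq_sum_univ' v, map_sum]
  simp only [map_smul, Finset.sum_apply, Pi.smul_apply, smul_eq_mul]

/-- A left inverse whose rows have at most one nonzero entry makes a matrix a generalized
permutation matrix. -/
theorem exists_perm_of_leftInverse {n : ℕ} {L M : (Fin n → ℝ) →L[ℝ] (Fin n → ℝ)}
    (hML : ∀ v, M (L v) = v)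
    (hM : ∀ i j k, i ≠ j → M (Pi.single i 1) k * M (Pi.single j 1) k = 0) :
    ∃ σ : Equiv.Perm (Fin n), ∀ i l, L (Pi.single l 1) i ≠ 0 ↔ l = σ i := by
  have hτ : ∀ k, ∃ i, M (Pi.single i 1) k ≠ 0 := by
    intro k
    by_contra! hk
    have := congrFun (hML (Pi.single k 1)) k
    rw [clm_apply_eq_sum] at this
    simp [hk] at this
  choose τ hτ using hτ
  -- Row `k` of `M` has its only nonzero entry at `τ k`, so row `k` of `M L = 1` is a nonzero
  -- multiple of row `τ k` of `L`.
  have hL : ∀ k l, L (Pi.single l 1) (τ k) ≠ 0 ↔ l = k := by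
    intro k l
    have := congrFun (hML (Pi.single l 1)) k
    rw [clm_apply_eq_sum, Finset.sum_eq_single (τ k)] at this
    · rcases eq_or_ne l k with rfl | hlk
      · rw [Pi.single_eq_same] at this
        exact iff_of_true (left_ne_zero_of_mul (by rw [this]; exact one_ne_zero)) rfl
      · rw [Pi.single_eq_of_ne hlk.symm] at this
        exact iff_of_false (fun h0 => h0 ((mul_eq_zero.1 this).resolve_right (hτ k))) hlk
    · intro i _ hi
      rw [(mul_eq_zero.1 (hM i (τ k) k hi)).resolve_right (hτ k), mul_zero]
    · simp
  have hinj : Function.Injective τ := fun k l hkl =>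
    ((hL k l).1 (hkl ▸ (hL l l).2 rfl)).symm
  let e : Equiv.Perm (Fin n) := Equiv.ofBijective τ (Finite.injective_iff_bijective.1 hinj)
  refine ⟨e.symm, fun i l => ?_⟩
  have := hL (e.symm i) l
  rwa [show τ (e.symm i) = i from e.apply_symm_apply i] at this

/-- An injective `C¹` map whose derivative is everywhere a generalized permutation matrix acts
component-wise up to a permutation. -/
theorem exists_componentwise {n : ℕ} {h : (Fin n → ℝ) → (Fin n → ℝ)} (hinj : Function.Injective h)
    (hh : ContDiff ℝ 1 h)
    (hperm : ∀ z, ∃ σ : Equiv.Perm (Fin n), ∀ i l,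
      fderiv ℝ h z (Pi.single l 1) i ≠ 0 ↔ l = σ i) :
    ∃ (σ : Equiv.Perm (Fin n)) (T : Fin n → ℝ → ℝ),
      (∀ i, Function.Injective (T i)) ∧ ∀ z i, h z i = T i (z (σ i)) := by
  choose s hs using hperm
  have hloc : IsLocallyConstant s := by
    -- Nonzero entries stay nonzero nearby, and each row has only one.
    rw [IsLocallyConstant.iff_eventually_eq]
    intro z
    have hc : ∀ i, ∀ᶠ z' in nhds z, fderiv ℝ h z' (Pi.single (s z i) 1) i ≠ 0 := by
      intro i
      have : Continuous fun z' => fderiv ℝ h z' (Pi.single (s z i) 1) i :=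
        (continuous_apply i).comp ((hh.continuous_fderiv (by norm_num)).clm_apply continuous_const)
      exact this.continuousAt.eventually_ne ((hs z i _).2 rfl)
    filter_upwards [Filter.eventually_all.2 hc] with z' hz'
    ext i
    rw [(hs z' i _).1 (hz' i)]
  set σ := s 0
  have hσ : ∀ z, s z = σ := fun z => hloc.apply_eq_of_preconnectedSpace z 0
  -- On the segment from `z` to `z'`, only the partial derivative along `σ i` could contribute, and
  -- the direction has no such component.
  have hdep : ∀ i z z', z (σ i) = z' (σ i) → h z i = h z' i := by
    intro i z z' hzz
    set v := z' - z
    have hderiv : ∀ a : ℝ, HasDerivAt (fun a : ℝ => h (z + a • v) i) 0 a := by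
      intro a
      have h1 : HasDerivAt (fun a : ℝ => z + a • v) v a := by
        simpa using ((hasDerivAt_id a).smul_const v).const_add z
      have h2 := ((hh.differentiable (by norm_num)) (z + a • v)).hasFDerivAt
      have h3 := hasDerivAt_pi.1 (h2.comp_hasDerivAt a h1) i
      refine h3.congr_deriv ?_
      rw [clm_apply_eq_sum]
      refine Finset.sum_eq_zero fun l _ => ?_
      by_cases hl : l = σ i
      · subst hl
        simp [v, hzz]
      · have := (hs (z + a • v) i l).not.2 (by rw [hσ]; exact hl)
        rw [not_not] at this
        exact mul_eq_zero_of_right _ this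
    have := is_const_of_deriv_eq_zero (fun a => (hderiv a).differentiableAt)
      (fun a => (hderiv a).deriv) 0 1
    simpa [v] using this
  refine ⟨σ, fun i x => h (Pi.single (σ i) x) i, fun i a b hab => ?_, fun z i => ?_⟩
  -- The two points differ only in coordinate `σ i`, which the other components of `h` ignore;
  -- injectivity of `h` then applies.
  · have : h (Pi.single (σ i) a) = h (Pi.single (σ i) b) := by
      ext j
      by_cases hj : j = i
      · subst hj; exact hab
      · refine hdep j _ _ ?_
        have : σ j ≠ σ i := fun h0 => hj (σ.injective h0)
        simp [this]
    simpa using congrFun (hinj this) (σ i)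
  · exact hdep i _ _ (by simp)

/-! ### The smooth inverse -/

theorem isOpenMap_of_det_fderiv_ne_zero {n : ℕ} {h : (Fin n → ℝ) → (Fin n → ℝ)}
    (hh : ContDiff ℝ 2 h) (hjac : ∀ z, (fderiv ℝ h z).det ≠ 0) : IsOpenMap h := by
  refine isOpenMap_of_hasStrictFDerivAt_equiv (f' := fun z =>
    (fderiv ℝ h z).toContinuousLinearEquivOfDetNeZero (hjac z)) fun z => ?_
  exact hh.contDiffAt.hasStrictFDerivAt (by norm_num)

/-- An injective `C²` map with nonvanishing Jacobian determinant has a `C²` left inverse on its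
range. -/
theorem exists_contDiffOn_inverse {n : ℕ} {h : (Fin n → ℝ) → (Fin n → ℝ)}
    (hh : ContDiff ℝ 2 h) (hjac : ∀ z, (fderiv ℝ h z).det ≠ 0) (ho : Topology.IsOpenEmbedding h) :
    ∃ ψ : (Fin n → ℝ) → (Fin n → ℝ), ContDiffOn ℝ 2 ψ (Set.range h) ∧ ∀ z, ψ (h z) = z := by
  have hψ : ∀ z, (ho.toOpenPartialHomeomorph h).symm (h z) = z := fun z =>
    ho.toOpenPartialHomeomorph_left_inv h
  refine ⟨(ho.toOpenPartialHomeomorph h).symm, ?_, hψ⟩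
  rintro _ ⟨z, rfl⟩
  refine ContDiffAt.contDiffWithinAt ?_
  refine OpenPartialHomeomorph.contDiffAt_symm _
    (f₀' := (fderiv ℝ h z).toContinuousLinearEquivOfDetNeZero (hjac z)) ?_ ?_ ?_
  · rw [ho.toOpenPartialHomeomorph_target]; exact ⟨z, rfl⟩
  · rw [hψ]
    exact (hh.differentiable (by norm_num) z).hasFDerivAt
  · rw [hψ]
    exact hh.contDiffAt

/-! ### Positive densities and linear independence -/

/-- The law with independent components of positive densities `p'` has an exponential density with
respect to the one of positive densities `p`. -/
theorem pi_eq_withDensity_exp {n : ℕ} {p p' : Fin n → ℝ → ℝ} (hpos : ∀ k ζ, 0 < p k ζ)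
    (hpos' : ∀ k ζ, 0 < p' k ζ) (hp : ∀ k, Measurable (p k)) (hp' : ∀ k, Measurable (p' k))
    {m m' : Fin n → Measure ℝ} [∀ k, IsProbabilityMeasure (m k)]
    [∀ k, IsProbabilityMeasure (m' k)]
    (hm : ∀ k, m k = volume.withDensity (fun ζ => ENNReal.ofReal (p k ζ)))
    (hm' : ∀ k, m' k = volume.withDensity (fun ζ => ENNReal.ofReal (p' k ζ))) :
    Measure.pi m' = (Measure.pi m).withDensity
      (fun z => ENNReal.ofReal (Real.exp (∑ k, (Real.log (p' k (z k)) - Real.log (p k (z k)))))) := by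
  have hq : ∀ k, Measurable fun ζ => ENNReal.ofReal (p' k ζ / p k ζ) := fun k =>
    ((hp' k).div (hp k)).ennreal_ofReal
  have hk : ∀ k, m' k = (m k).withDensity (fun ζ => ENNReal.ofReal (p' k ζ / p k ζ)) := by
    intro k
    rw [hm k, hm' k, ← withDensity_mul _ (hp k).ennreal_ofReal (hq k)]
    congr 1
    ext ζ
    simp only [Pi.mul_apply]
    rw [← ENNReal.ofReal_mul (hpos k ζ).le, mul_div_cancel₀ _ (hpos k ζ).ne']
  have hsf : ∀ k, SigmaFinite ((m k).withDensity (fun ζ => ENNReal.ofReal (p' k ζ / p k ζ))) :=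
    fun k => hk k ▸ inferInstance
  have : Measure.pi m'
      = Measure.pi fun k => (m k).withDensity (fun ζ => ENNReal.ofReal (p' k ζ / p k ζ)) := by
    congr 1
    exact funext hk
  rw [this, pi_withDensity_eq m hq]
  congr 1
  ext z
  rw [Real.exp_sum, ENNReal.ofReal_prod_of_nonneg fun k _ => (Real.exp_pos _).le]
  refine Finset.prod_congr rfl fun k _ => ?_
  rw [Real.exp_sub, Real.exp_log (hpos' _ _), Real.exp_log (hpos _ _)]

/-- Needed to pass from almost everywhere to everywhere for continuous identities. -/
theorem isOpenPosMeasure_pi_of_pos_density {n : ℕ} {p : Fin n → ℝ → ℝ}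
    (hpos : ∀ k ζ, 0 < p k ζ) (hp : ∀ k, Measurable (p k))
    {m : Fin n → Measure ℝ} [∀ k, IsProbabilityMeasure (m k)]
    (hm : ∀ k, m k = volume.withDensity (fun ζ => ENNReal.ofReal (p k ζ))) :
    (Measure.pi m).IsOpenPosMeasure := by
  have : ∀ k, (m k).IsOpenPosMeasure := by
    intro k
    have hac : (volume : Measure ℝ) ≪ m k := by
      rw [hm k]
      refine withDensity_absolutelyContinuous' (hp k).ennreal_ofReal.aemeasurable ?_
      exact Filter.Eventually.of_forall fun ζ => (ENNReal.ofReal_pos.2 (hpos k ζ)).ne'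
    exact hac.isOpenPosMeasure
  infer_instance

/-- Linear independence of the vectors of a temporal model without dependence on the past, in terms
of the differences of the log-densities between consecutive contexts. -/
theorem coeff_eq_zero_of_linearIndependent {m n : ℕ} (η : Fin m → Fin n → ℝ → ℝ)
    (hd : ∀ r k, Differentiable ℝ (η r k)) (hd2 : ∀ r k, Differentiable ℝ (deriv (η r k)))
    (z : Fin n → ℝ)
    (hlin : LinearIndependent ℝ
      (Sum.elim
        (fun k w => sVec (fun r ζ _ => η r k ζ) (z k) w)
        (fun k w => sRing (fun r ζ _ => η r k ζ) (z k) w) :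
        Fin n ⊕ Fin n → (Fin n → ℝ) → ((Fin m × Fin n) ⊕ Fin (m - 1) → ℝ)))
    {a b : Fin n → ℝ}
    (hab : ∀ r r' : Fin m, r.val + 1 = r'.val →
      ∑ k, (deriv (deriv (fun x => η r' k x - η r k x)) (z k) * a k
        + deriv (fun x => η r' k x - η r k x) (z k) * b k) = 0) (k : Fin n) :
    a k = 0 := by
  rw [Fintype.linearIndependent_iff] at hlin
  refine hlin (Sum.elim a b) ?_ (Sum.inl k)
  have hd1 : ∀ r r' k, deriv (fun x => η r' k x - η r k x)
      = fun x => deriv (η r' k) x - deriv (η r k) x := fun r r' k =>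
    funext fun x => deriv_fun_sub (hd r' k x) (hd r k x)
  ext w c
  simp only [Fintype.sum_sum_type, Sum.elim_inl, Sum.elim_inr, Finset.sum_apply,
    Pi.smul_apply, smul_eq_mul, Pi.zero_apply, ← Finset.sum_add_distrib]
  rcases c with ⟨r, l⟩ | r
  -- These entries differentiate in the past, on which the log-densities do not depend; only the
  -- context differences constrain the coefficients.
  · simp [sVec, sRing, vVec, vRing]
  · rw [← hab ⟨r.val, by have := r.isLt; omega⟩ ⟨r.val + 1, by have := r.isLt; omega⟩ rfl]
    refine Finset.sum_congr rfl fun k _ => ?_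
    simp only [sVec, sRing, hd1, iteratedDeriv_succ, iteratedDeriv_zero]
    rw [deriv_fun_sub (hd2 _ k _) (hd2 _ k _)]
    ring

end TemporalLatent

/-! ### Identifiability of the latent components -/

theorem theorem3 {m n : ℕ} {Ω : Type*} [MeasurableSpace Ω] [StandardBorelSpace Ω] {𝒳 : Type*}
    -- the law of the processes in each of the `m` contexts
    (P : Fin m → Measure Ω) [∀ r, IsProbabilityMeasure (P r)]
    -- latent process `Z`, observed process `X`, estimated latent process `Zhat`
    (Z : ℕ → Ω → Fin n → ℝ) (hZ : ∀ s, Measurable (Z s))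
    (g : (Fin n → ℝ) → 𝒳) (hg : Function.Injective g)
    (X : ℕ → Ω → 𝒳) (hX : ∀ s ω, X s ω = g (Z s ω))
    (ghat : 𝒳 → Fin n → ℝ) (hghat : Set.InjOn ghat (Set.range g))
    (Zhat : ℕ → Ω → Fin n → ℝ) (hZhat : ∀ s ω, Zhat s ω = ghat (X s ω))
    (hZhat_meas : ∀ s, Measurable (Zhat s))
    -- the transformation from true to estimated latents is a change of variables
    (hsmooth : ContDiff ℝ 2 (fun z => ghat (g z)))
    (hjac : ∀ z, (fderiv ℝ (fun z => ghat (g z)) z).det ≠ 0)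
    -- current time `t + 1`, previous time `t`
    (t : ℕ)
    -- in each context, the current latents do not depend on the history
    (hhist : ∀ r, IndepFun (Z t) (Z (t + 1)) (P r))
    -- in each context, the current latent components are mutually independent
    (hindep : ∀ r, iIndepFun (fun k ω => Z (t + 1) ω k) (P r))
    -- `p r k` is the density of the `k`-th current component in context `r`
    (p : Fin m → Fin n → ℝ → ℝ)
    (hpos : ∀ r k ζ, 0 < p r k ζ)
    (hp : ∀ r k, (P r).map (fun ω => Z (t + 1) ω k)
      = volume.withDensity (fun ζ => ENNReal.ofReal (p r k ζ)))
    (hdiff : ∀ r k, Differentiable ℝ (fun ζ => Real.log (p r k ζ)))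
    (hdiff2 : ∀ r k, Differentiable ℝ (deriv (fun ζ => Real.log (p r k ζ))))
    -- in each context, the estimated components are independent given the estimated past
    (hcond : ∀ r, TemporalLatent.CondIndepComponents (P r) (Zhat (t + 1)) (Zhat t) (hZhat_meas t))
    -- for each value `z` of the current latents, the `2n` vector functions of the previous
    -- latents are linearly independent
    (hlin : ∀ z : Fin n → ℝ, LinearIndependent ℝ
      (Sum.elim
        (fun k w => TemporalLatent.sVec (fun r ζ _ => Real.log (p r k ζ)) (z k) w)
        (fun k w => TemporalLatent.sRing (fun r ζ _ => Real.log (p r k ζ)) (z k) w) :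
        Fin n ⊕ Fin n → (Fin n → ℝ) → ((Fin m × Fin n) ⊕ Fin (m - 1) → ℝ))) :
    ∃ (σ : Equiv.Perm (Fin n)) (T : Fin n → ℝ → ℝ),
      (∀ i, Function.Injective (T i)) ∧
      (∀ z i, ghat (g z) i = T i (z (σ i))) ∧
      (∀ ω i, Zhat (t + 1) ω i = T i (Z (t + 1) ω (σ i))) := by
  set h : (Fin n → ℝ) → (Fin n → ℝ) := fun z => ghat (g z) with hh
  have hinj : Function.Injective h := fun z z' hz => hg (hghat ⟨z, rfl⟩ ⟨z', rfl⟩ hz)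
  have ho : Topology.IsOpenEmbedding h :=
    .of_continuous_injective_isOpenMap hsmooth.continuous hinj
      (TemporalLatent.isOpenMap_of_det_fderiv_ne_zero hsmooth hjac)
  have hZh : ∀ s, Zhat s = fun ω => h (Z s ω) := fun s => funext fun ω => by
    rw [hZhat, hX]
  have hpm : ∀ r k, Measurable (p r k) := by
    intro r k
    have h1 : p r k = fun ζ => Real.exp (Real.log (p r k ζ)) :=
      funext fun ζ => (Real.exp_log (hpos r k ζ)).symm
    rw [h1]
    exact (Real.continuous_exp.comp (hdiff r k).continuous).measurable
  have hZk : ∀ k, Measurable (fun ω => Z (t + 1) ω k) := fun k =>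
    (measurable_pi_apply k).comp (hZ (t + 1))
  have hZhk : ∀ k, Measurable (fun ω => Zhat (t + 1) ω k) := fun k =>
    (measurable_pi_apply k).comp (hZhat_meas (t + 1))
  have hprobZ : ∀ r k, IsProbabilityMeasure ((P r).map (fun ω => Z (t + 1) ω k)) := fun r k =>
    Measure.isProbabilityMeasure_map (hZk k).aemeasurable
  have hprobZh : ∀ r k, IsProbabilityMeasure ((P r).map (fun ω => Zhat (t + 1) ω k)) := fun r k =>
    Measure.isProbabilityMeasure_map (hZhk k).aemeasurable
  have hlawZ : ∀ r, (P r).map (Z (t + 1)) = Measure.pi fun k => (P r).map fun ω => Z (t + 1) ω k :=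
    fun r => (iIndepFun_iff_map_fun_eq_pi_map fun k => (hZk k).aemeasurable).1 (hindep r)
  have hlawZh : ∀ r, (Measure.pi fun k => (P r).map fun ω => Z (t + 1) ω k).map h
      = Measure.pi fun k => (P r).map fun ω => Zhat (t + 1) ω k := by
    intro r
    have hind : IndepFun (Zhat t) (Zhat (t + 1)) (P r) := by
      rw [hZh, hZh]
      exact (hhist r).comp hsmooth.continuous.measurable hsmooth.continuous.measurable
    have h1 := TemporalLatent.iIndepFun_of_condIndepComponents (hZhat_meas (t + 1))
      (hZhat_meas t) hind (hcond r)
    have h2 := (iIndepFun_iff_map_fun_eq_pi_map fun k => (hZhk k).aemeasurable).1 h1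
    rw [← hlawZ, Measure.map_map hsmooth.continuous.measurable (hZ (t + 1)), ← h2]
    exact congrArg (fun f => (P r).map f) (hZh (t + 1)).symm
  obtain ⟨ψ, hψ, hψh⟩ := TemporalLatent.exists_contDiffOn_inverse hsmooth hjac ho
  -- At each point, the mixed-derivative identities over all consecutive contexts form one linear
  -- relation among the `2n` vectors, whose coefficients on the `sVec` are these products.
  have hmixed : ∀ z i j k, i ≠ j →
      fderiv ℝ ψ (h z) (Pi.single j 1) k * fderiv ℝ ψ (h z) (Pi.single i 1) k = 0 := by
    intro z i j k hij
    refine TemporalLatent.coeff_eq_zero_of_linearIndependent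
      (a := fun k => fderiv ℝ ψ (h z) (Pi.single j 1) k * fderiv ℝ ψ (h z) (Pi.single i 1) k)
      (b := fun k =>
        fderiv ℝ (fun x => fderiv ℝ ψ x (Pi.single i 1)) (h z) (Pi.single j 1) k)
      (fun r k ζ => Real.log (p r k ζ)) hdiff hdiff2 z (hlin z) (fun r r' _ => ?_) k
    have hd2 : ∀ k, Differentiable ℝ
        (deriv fun x => Real.log (p r' k x) - Real.log (p r k x)) := by
      intro k
      have h1 : (deriv fun x => Real.log (p r' k x) - Real.log (p r k x))
          = fun x => deriv (fun x => Real.log (p r' k x)) x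
            - deriv (fun x => Real.log (p r k x)) x :=
        funext fun x => deriv_fun_sub (hdiff r' k x) (hdiff r k x)
      rw [h1]
      exact (hdiff2 r' k).sub (hdiff2 r k)
    have key := TemporalLatent.sum_second_deriv_eq_zero ho.isOpen_range hψ
      (d := fun k x => Real.log (p r' k x) - Real.log (p r k x))
      (fun k => (hdiff r' k).sub (hdiff r k)) hd2 hij ?_ (Set.mem_range_self z)
    · simpa only [hψh] using key
    · rintro _ ⟨x, rfl⟩ _ ⟨x', rfl⟩ ⟨w, hw⟩ ⟨w', hw'⟩
      rw [← hw, ← hw']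
      simp only [hψh]
      have := TemporalLatent.isOpenPosMeasure_pi_of_pos_density (hpos r) (hpm r) (hp r)
      refine TemporalLatent.add_eq_add_of_map_eq_pi ho
        (D := fun z => ∑ k, (Real.log (p r' k (z k)) - Real.log (p r k (z k)))) ?_
        (TemporalLatent.pi_eq_withDensity_exp (hpos r) (hpos r') (hpm r) (hpm r') (hp r) (hp r'))
        (hlawZh r) (hlawZh r') hw hw'
      exact continuous_finsetSum _ fun k _ =>
        ((hdiff r' k).continuous.comp (continuous_apply k)).sub
          ((hdiff r k).continuous.comp (continuous_apply k))
  obtain ⟨σ, T, hT, hTz⟩ := TemporalLatent.exists_componentwise hinj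
    (hsmooth.of_le (by norm_num)) fun z => by
      refine TemporalLatent.exists_perm_of_leftInverse (M := fderiv ℝ ψ (h z)) (fun v => ?_)
        (fun i j k hij => hmixed z j i k hij.symm)
      have h1 : HasFDerivAt ψ (fderiv ℝ ψ (h z)) (h z) :=
        ((hψ.contDiffAt (ho.isOpen_range.mem_nhds (Set.mem_range_self z))).differentiableAt
          (by norm_num)).hasFDerivAt
      have h2 := h1.comp z (hsmooth.differentiable (by norm_num) z).hasFDerivAt
      have h3 : ψ ∘ h = id := funext hψh
      rw [h3] at h2
      exact DFunLike.congr_fun (h2.unique (hasFDerivAt_id z)) v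
  exact ⟨σ, T, hT, hTz, fun ω i => by rw [hZh]; exact hTz _ i⟩
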